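/- **Conventions.** Let $V$ be a real vector space with a symmetric bilinear form $(\cdot,\cdot)$. *Indecomposable affine root systems.* Let $A=(a_{ij})_{i,j=1}^{n}$, $n\ge 1$, be an indecomposable generalized Cartan matrix of affine type, i.e. an integer matrix with $a_{ii}=2$, $a_{ij}\le 0$ for $i\ne j$, $a_{ij}=0\iff a_{ji}=0$, not block-diagonal after any simultaneous permutation of rows and columns, for which there are (unique) coprime positive integers $a_1,\dots,a_n$ with $\sum_j a_{ij}a_j=0$ for all $i$. Let $\alpha_1,\dots,\alpha_n\in V$ be linearly independent with $(\alpha_i,\alpha_i)>0$ and $2(\alpha_i,\alpha_j)/(\alpha_i,\alpha_i)=a_{ij}$ for all $i,j$. Let $W$ be the group generated by the reflections $v\mapsto v-\frac{2(\alpha_i,v)}{(\alpha_i,\alpha_i)}\alpha_i$ and let $\delta=\sum_i a_i\alpha_i$. The corresponding *indecomposable affine root system*, with basic imaginary root $\delta$, is $$\Delta=W\{\alpha_1,\dots,\alpha_n\}\ \cup\ \{m\delta : m\in\mathbb Z,\ m\neq 0\},$$ that is, the set of all real and imaginary roots of the affine Kac–Moody algebra with Cartan matrix $A$ (untwisted or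 twisted). *Affine root systems.* An *affine root system* in $V$ is a nonempty finite union of mutually orthogonal indecomposable affine root systems in $V$ whose basic imaginary roots are all integer multiples of members of one linearly independent set of vectors. (This includes direct sums of indecomposable affine root systems, as well as unions of mutually orthogonal indecomposable affine root systems contained in one indecomposable affine root system.) The *root lattice* of $\Delta$ is the additive subgroup of $V$ generated by $\Delta$. **Theorem.** Let $\Delta$ and $\Delta_1\subset\Delta$ be affine root systems in $V$ (with respect to the same form, and not necessarily of the same rank), and let $L_1\subset L$ be the root lattices of $\Delta_1$ and $\Delta$. Then $\Delta_1$ is a root subsystem of $\Delta$, that is, $\alpha+\beta\in\Delta_1$ whenever $\alpha,\beta\in\Delta_1$ and $\alpha+\beta\in\Delta$, if and only if $\Delta_1=\Delta\cap L_1$. -/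

import Mathlib

/-- An indecomposable generalized Cartan matrix. -/
structure IsIndecomposableGCM {ι : Type*} (A : Matrix ι ι ℤ) : Prop where
  nonempty : Nonempty ι
  diag : ∀ i, A i i = 2
  offDiag : ∀ i j, i ≠ j → A i j ≤ 0
  zero_symm : ∀ i j, A i j = 0 → A j i = 0
  indecomposable : ∀ s : Set ι, s.Nonempty → sᶜ.Nonempty → ∃ i ∈ s, ∃ j ∈ sᶜ, A i j ≠ 0

/-- `a` is a vector of coprime positive integers annihilated by `A`.  An indecomposable generalized
Cartan matrix is of affine type if and only if such a vector exists, and the vector is then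
unique. -/
structure IsMarks {ι : Type*} [Fintype ι] (A : Matrix ι ι ℤ) (a : ι → ℤ) : Prop where
  pos : ∀ i, 0 < a i
  null : A.mulVec a = 0
  coprime : Finset.univ.gcd a = 1

section AffineRootSystems

variable {V : Type*} [AddCommGroup V] [Module ℝ V]

/-- `α` is a linearly independent family of simple roots whose Cartan matrix
`A i j = 2 (α i, α j) / (α i, α i)` with respect to the form `B` is an indecomposable
generalized Cartan matrix of affine type, with marks `a`. -/
structure IsAffineBase (B : LinearMap.BilinForm ℝ V) {ι : Type*} [Fintype ι]
    (A : Matrix ι ι ℤ) (a : ι → ℤ) (α : ι → V) : Prop where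
  gcm : IsIndecomposableGCM A
  marks : IsMarks A a
  linearIndependent : LinearIndependent ℝ α
  norm_pos : ∀ i, 0 < B (α i) (α i)
  cartan : ∀ i j, 2 * B (α i) (α j) = (A i j : ℝ) * B (α i) (α i)

/-- The reflection `v ↦ v - (2 (a, v) / (a, a)) a` in a vector `a` of nonzero norm. -/
noncomputable def rootReflection (B : LinearMap.BilinForm ℝ V) (a v : V) : V :=
  v - (2 * B a v / B a a) • a

/-- The real roots: the orbit of the simple roots under the Weyl group, that is, under the group
generated by the simple reflections (which are involutions). -/
inductive IsRealRoot (B : LinearMap.BilinForm ℝ V) {ι : Type*} (α : ι → V) : V → Prop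
  | simple (i : ι) : IsRealRoot B α (α i)
  | reflect (i : ι) (β : V) : IsRealRoot B α β → IsRealRoot B α (rootReflection B (α i) β)

/-- `Δ` is the root system of an affine Kac--Moody algebra with indecomposable generalized Cartan
matrix, and `δ` is its basic imaginary root: the real roots are the Weyl group orbit of the simple
roots, and the imaginary roots are the nonzero integer multiples of `δ = ∑ i, a i • α i`. -/
def IsIndecomposableAffineRootSystem (B : LinearMap.BilinForm ℝ V) (Δ : Set V) (δ : V) : Prop :=
  ∃ (n : ℕ) (A : Matrix (Fin n) (Fin n) ℤ) (a : Fin n → ℤ) (α : Fin n → V),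
    IsAffineBase B A a α ∧ δ = ∑ i, a i • α i ∧
      Δ = {β | IsRealRoot B α β} ∪ {β | ∃ m : ℤ, m ≠ 0 ∧ β = m • δ}

/-- `Δ` is an affine root system, possibly decomposable: a nonempty finite union of mutually
orthogonal indecomposable affine root systems `Γ k`.  The basic imaginary roots `δ k` are integer
multiples of members of one linearly independent set `E`.  This comprises direct sums (`E` is the
set of all `δ k`) and orthogonal unions inside one indecomposable affine root system
(`E` consists of its basic imaginary root). -/
def IsAffineRootSystem (B : LinearMap.BilinForm ℝ V) (Δ : Set V) : Prop :=
  ∃ (r : ℕ) (Γ : Fin r → Set V) (δ : Fin r → V) (E : Set V),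
    0 < r ∧
    (∀ k, IsIndecomposableAffineRootSystem B (Γ k) (δ k)) ∧
    (∀ k l, k ≠ l → ∀ x ∈ Γ k, ∀ y ∈ Γ l, B x y = 0) ∧
    LinearIndepOn ℝ id E ∧
    (∀ k, ∃ e ∈ E, ∃ m : ℤ, δ k = m • e) ∧
    Δ = ⋃ k, Γ k

/-- The condition that singles out root subsystems `Δ₁ ⊆ Δ`: closedness under addition in `Δ`. -/
def IsClosedIn (Δ₁ Δ : Set V) : Prop :=
  ∀ x ∈ Δ₁, ∀ y ∈ Δ₁, x + y ∈ Δ → x + y ∈ Δ₁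

/-- The root lattice: the additive group generated by the roots. -/
def rootLattice (Δ : Set V) : AddSubgroup V := AddSubgroup.closure Δ

end AffineRootSystems

/-! The proof lifts the elementary argument for finite root systems to the affine setting. On the
lattice spanned by an affine base the form is positive semidefinite, because the null vector with
positive entries turns it into a weighted sum of squares of differences
(`sum_mul_eq_neg_half_sum_sq`), and indecomposability together with coprimality of the marks shows
that its isotropic vectors are the integer multiples of `δ`. Hence, if `x`, `y` are roots with
`(x, y) > 0`, then `x - y` is a root or zero (`IsAffineRootSystem.sub_mem_or_eq`): the Cartan
integers of `x` and `y` are positive with product at most `4`, so either one of them is `1` and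
`x - y` is plus or minus a reflection of a root, or both are `2` and `x - y` is isotropic.

Let `Δ₁` be closed in `Δ`, and let a root `x` of `Δ` be a sum of `n` elements of `Δ₁`. If
`(x, x) > 0`, then `(x, β) > 0` for a summand `β`, so that `x - β` is zero or a root of `Δ` which is
a sum of `n - 1` elements of `Δ₁`, and induction applies. If `x` is isotropic, semidefiniteness on
each component makes it an integer combination of isotropic roots of `Δ₁`
(`IsAffineRootSystem.mem_closure_isotropic`). Projecting to the line of the independent set that
contains `x` reduces this case to a statement on subsets of `ℤ`, namely
`Int.mem_of_mem_closure_of_add_mem`, which rests on the distributivity of the divisibility lattice.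
-/

/-! ### A closure property of sets of integers -/

/-- A set of integers stable under multiples, in which sums divisible by `N` stay, contains `N` as
soon as it generates `N`. -/
theorem Int.mem_of_mem_closure_of_add_mem {S : Set ℤ} {N : ℤ} (h0 : (0 : ℤ) ∈ S)
    (hmul : ∀ s ∈ S, ∀ t : ℤ, t * s ∈ S)
    (hadd : ∀ s ∈ S, ∀ t ∈ S, N ∣ s + t → s + t ∈ S)
    (hN : N ∈ AddSubgroup.closure S) : N ∈ S := by
  let G : AddSubgroup ℤ :=
    { carrier := {s | s ∈ S ∧ N ∣ s}
      zero_mem' := ⟨h0, dvd_zero N⟩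
      add_mem' := fun {a b} ha hb =>
        ⟨hadd a ha.1 b hb.1 (dvd_add ha.2 hb.2), dvd_add ha.2 hb.2⟩
      neg_mem' := fun {a} ha => ⟨by simpa using hmul a ha.1 (-1), (dvd_neg).2 ha.2⟩ }
  obtain ⟨g, hg⟩ := Int.subgroup_cyclic G
  have hG : ∀ z, z ∈ G ↔ g ∣ z := by
    intro z
    rw [hg, AddSubgroup.mem_closure_singleton]
    constructor
    · rintro ⟨k, rfl⟩
      exact ⟨k, by simp [mul_comm]⟩
    · rintro ⟨k, rfl⟩
      exact ⟨k, by simp [mul_comm]⟩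
  -- `g` divides the least common multiple of `N` and any element of the closure
  have key : ∀ z ∈ AddSubgroup.closure S, ∀ w, z ∣ w → N ∣ w → g ∣ w := by
    intro z hz
    induction hz using AddSubgroup.closure_induction with
    | mem s hs =>
      rintro w ⟨t, rfl⟩ hNw
      exact (hG _).1 ⟨by simpa [mul_comm] using hmul s hs t, hNw⟩
    | zero =>
      intro w hw _
      rw [zero_dvd_iff.1 hw]
      exact dvd_zero g
    | neg x _ ih => exact fun w hw => ih w ((neg_dvd).1 hw)
    | add x y _ _ ihx ihy =>
      intro w hw hNw
      have hxg : (Int.gcd x y : ℤ) ∣ x := Int.gcd_dvd_left ..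
      have hyg : (Int.gcd x y : ℤ) ∣ y := Int.gcd_dvd_right ..
      by_cases hd : (Int.gcd x y : ℤ) = 0
      · have hy : y = 0 := zero_dvd_iff.1 (hd ▸ hyg)
        rw [hy, add_zero] at hw
        exact ihx w hw hNw
      have hb := Int.gcd_eq_gcd_ab x y
      obtain ⟨p, hp⟩ := hxg
      obtain ⟨q, hq⟩ := hyg
      obtain ⟨w', hw'⟩ : (Int.gcd x y : ℤ) ∣ w :=
        (dvd_add (Int.gcd_dvd_left ..) (Int.gcd_dvd_right ..)).trans hw
      set d : ℤ := (Int.gcd x y : ℤ)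
      -- `p * w` and `q * w` are common multiples of `N` and of `x`, respectively `y`
      have h1 : g ∣ p * w := ihx _ ⟨w', by rw [hw']; linear_combination (-w') * hp⟩
        (hNw.mul_left p)
      have h2 : g ∣ q * w := ihy _ ⟨w', by rw [hw']; linear_combination (-w') * hq⟩
        (hNw.mul_left q)
      have h3 : p * Int.gcdA x y + q * Int.gcdB x y = 1 := by
        apply mul_left_cancel₀ hd
        linear_combination -hb - (Int.gcdA x y) * hp - (Int.gcdB x y) * hq
      have h4 : w = Int.gcdA x y * (p * w) + Int.gcdB x y * (q * w) := by
        linear_combination (-w) * h3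
      rw [h4]
      exact dvd_add (h1.mul_left _) (h2.mul_left _)
  exact ((hG N).2 (key N hN N dvd_rfl dvd_rfl)).1

/-! ### The form on the lattice of an affine base -/

theorem sum_mul_eq_neg_half_sum_sq {ι : Type*} [Fintype ι] (c : ι → ι → ℝ) (y : ι → ℝ)
    (hsymm : ∀ i j, c i j = c j i) (hrow : ∀ i, ∑ j, c i j = 0) :
    ∑ i, ∑ j, c i j * (y i * y j) = -(1 / 2) * ∑ i, ∑ j, c i j * (y i - y j) ^ 2 := by
  have h1 : ∑ i, ∑ j, c i j * y i ^ 2 = 0 := by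
    simp_rw [← Finset.sum_mul, hrow, zero_mul, Finset.sum_const_zero]
  have h2 : ∑ i, ∑ j, c i j * y j ^ 2 = 0 := by
    rw [Finset.sum_comm, ← h1]
    exact Finset.sum_congr rfl fun i _ => Finset.sum_congr rfl fun j _ => by rw [hsymm]
  have h3 : ∑ i, ∑ j, c i j * (y i - y j) ^ 2 = ∑ i, ∑ j, c i j * y i ^ 2
      + ∑ i, ∑ j, c i j * y j ^ 2 - 2 * ∑ i, ∑ j, c i j * (y i * y j) := by
    simp_rw [Finset.mul_sum, ← Finset.sum_add_distrib, ← Finset.sum_sub_distrib]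
    exact Finset.sum_congr rfl fun i _ => Finset.sum_congr rfl fun j _ => by ring
  rw [h3, h1, h2]
  ring

section AffineBase

variable {V : Type*} [AddCommGroup V] [Module ℝ V] {B : LinearMap.BilinForm ℝ V}
  {ι : Type*} [Fintype ι] {A : Matrix ι ι ℤ} {a : ι → ℤ} {α : ι → V}

theorem IsAffineBase.apply_delta (h : IsAffineBase B A a α) (i : ι) :
    B (α i) (∑ j, a j • α j) = 0 := by
  have h1 : 2 * B (α i) (∑ j, a j • α j) = ((A.mulVec a i : ℤ) : ℝ) * B (α i) (α i) := by
    simp only [map_sum, map_zsmul, Matrix.mulVec, dotProduct, Int.cast_sum, Int.cast_mul,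
      Finset.mul_sum, Finset.sum_mul, zsmul_eq_mul]
    exact Finset.sum_congr rfl fun j _ => by linear_combination (a j : ℝ) * h.cartan i j
  rw [h.marks.null] at h1
  simpa using h1

theorem IsAffineBase.apply_delta_left (h : IsAffineBase B A a α) (hB : B.IsSymm) {x : V}
    (hx : x ∈ Submodule.span ℤ (Set.range α)) : B (∑ j, a j • α j) x = 0 := by
  induction hx using Submodule.span_induction with
  | mem x hx =>
    obtain ⟨i, rfl⟩ := hx
    rw [hB.eq, h.apply_delta]
  | zero => simp
  | add x y _ _ hx hy => rw [map_add, hx, hy, add_zero]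
  | smul k x _ hx => rw [map_zsmul, hx, smul_zero]

theorem IsAffineBase.apply_ne_zero (h : IsAffineBase B A a α) {i j : ι} (hA : A i j ≠ 0) :
    B (α i) (α j) ≠ 0 := by
  intro h0
  have h1 := h.cartan i j
  rw [h0, mul_zero, eq_comm, mul_eq_zero] at h1
  rcases h1 with h1 | h1
  · exact hA (by exact_mod_cast h1)
  · exact (h.norm_pos i).ne' h1

theorem IsAffineBase.apply_nonpos (h : IsAffineBase B A a α) {i j : ι} (hij : i ≠ j) :
    B (α i) (α j) ≤ 0 := by
  have h1 := h.cartan i j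
  have h2 : (A i j : ℝ) ≤ 0 := by exact_mod_cast h.gcm.offDiag i j hij
  nlinarith [mul_nonpos_of_nonpos_of_nonneg h2 (h.norm_pos i).le]

/-- The form as a sum of squares, in terms of the coordinates divided by the marks. -/
theorem IsAffineBase.apply_self_eq (h : IsAffineBase B A a α) (hB : B.IsSymm) (c : ι → ℤ) :
    B (∑ i, c i • α i) (∑ i, c i • α i) = ∑ i, ∑ j, (-(B (α i) (α j)) * (a i * a j) / 2)
      * ((c i / a i : ℝ) - c j / a j) ^ 2 := by
  have ha : ∀ i, (a i : ℝ) ≠ 0 := fun i => by exact_mod_cast (h.marks.pos i).ne'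
  have h1 := sum_mul_eq_neg_half_sum_sq (fun i j => B (α i) (α j) * (a i * a j))
    (fun i => (c i / a i : ℝ)) (fun i j => by rw [hB.eq]; ring) (fun i => by
      have h2 := h.apply_delta i
      simp only [map_sum, map_zsmul, zsmul_eq_mul] at h2
      calc ∑ j, B (α i) (α j) * (a i * a j) = a i * ∑ j, a j * B (α i) (α j) := by
            rw [Finset.mul_sum]
            exact Finset.sum_congr rfl fun j _ => by ring
        _ = 0 := by rw [h2, mul_zero])
  calc B (∑ i, c i • α i) (∑ i, c i • α i)
      = ∑ i, ∑ j, B (α i) (α j) * (a i * a j) * ((c i / a i : ℝ) * (c j / a j)) := by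
        simp only [map_sum, map_zsmul, LinearMap.sum_apply, LinearMap.smul_apply, zsmul_eq_mul,
          Finset.mul_sum]
        rw [Finset.sum_comm]
        refine Finset.sum_congr rfl fun i _ => Finset.sum_congr rfl fun j _ => ?_
        field_simp [ha i, ha j]
    _ = _ := by
        rw [h1, Finset.mul_sum]
        simp_rw [Finset.mul_sum]
        exact Finset.sum_congr rfl fun i _ => Finset.sum_congr rfl fun j _ => by ring

theorem IsAffineBase.summand_nonneg (h : IsAffineBase B A a α) (c : ι → ℤ) (i j : ι) :
    0 ≤ (-(B (α i) (α j)) * (a i * a j) / 2) * ((c i / a i : ℝ) - c j / a j) ^ 2 := by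
  by_cases hij : i = j
  · simp [hij]
  · have hi : (0 : ℝ) < a i := by exact_mod_cast h.marks.pos i
    have hj : (0 : ℝ) < a j := by exact_mod_cast h.marks.pos j
    have := neg_nonneg.2 (h.apply_nonpos hij)
    positivity

theorem IsAffineBase.apply_self_nonneg (h : IsAffineBase B A a α) (hB : B.IsSymm) {x : V}
    (hx : x ∈ Submodule.span ℤ (Set.range α)) : 0 ≤ B x x := by
  obtain ⟨c, rfl⟩ := (Submodule.mem_span_range_iff_exists_fun ℤ).1 hx
  rw [h.apply_self_eq hB]
  exact Finset.sum_nonneg fun i _ => Finset.sum_nonneg fun j _ => h.summand_nonneg c i j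

/-- Coprimality of the marks makes `δ` primitive, so that the multiple is an integer. -/
theorem IsAffineBase.exists_eq_zsmul_delta (h : IsAffineBase B A a α) (hB : B.IsSymm) {x : V}
    (hx : x ∈ Submodule.span ℤ (Set.range α)) (hxx : B x x = 0) :
    ∃ m : ℤ, x = m • ∑ i, a i • α i := by
  obtain ⟨c, rfl⟩ := (Submodule.mem_span_range_iff_exists_fun ℤ).1 hx
  have ha : ∀ i, (a i : ℝ) ≠ 0 := fun i => by exact_mod_cast (h.marks.pos i).ne'
  rw [h.apply_self_eq hB, Finset.sum_eq_zero_iff_of_nonneg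
    fun i _ => Finset.sum_nonneg fun j _ => h.summand_nonneg c i j] at hxx
  have hadj : ∀ i j, A i j ≠ 0 → (c i / a i : ℝ) = c j / a j := by
    intro i j hij
    have h1 := hxx i (Finset.mem_univ i)
    rw [Finset.sum_eq_zero_iff_of_nonneg fun j _ => h.summand_nonneg c i j] at h1
    have h2 := h1 j (Finset.mem_univ j)
    have h3 := h.apply_ne_zero hij
    simpa [ha, h3, sub_eq_zero] using h2
  obtain ⟨i₀⟩ := h.gcm.nonempty
  have hconst : ∀ j, (c j / a j : ℝ) = c i₀ / a i₀ := by
    by_contra! hne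
    obtain ⟨j, hj⟩ := hne
    obtain ⟨i, hi, k, hk, hik⟩ := h.gcm.indecomposable {i | (c i / a i : ℝ) = c i₀ / a i₀}
      ⟨i₀, rfl⟩ ⟨j, hj⟩
    exact hk ((hadj i k hik).symm.trans hi)
  have hcross : ∀ j, c j * a i₀ = c i₀ * a j := fun j => by
    have h1 := hconst j
    rw [div_eq_div_iff (ha j) (ha i₀)] at h1
    exact_mod_cast h1
  have hdvd : a i₀ ∣ c i₀ := by
    have h1 : a i₀ ∣ Finset.univ.gcd fun j => c i₀ * a j :=
      Finset.dvd_gcd fun j _ => ⟨c j, by rw [← hcross j, mul_comm]⟩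
    rw [Finset.gcd_mul_left, h.marks.coprime, mul_one] at h1
    exact (dvd_normalize_iff).1 h1
  obtain ⟨m, hm⟩ := hdvd
  refine ⟨m, ?_⟩
  rw [Finset.smul_sum]
  refine Finset.sum_congr rfl fun j _ => ?_
  rw [smul_smul]
  congr 1
  apply mul_right_cancel₀ (h.marks.pos i₀).ne'
  rw [hcross j, hm]
  ring

theorem IsAffineBase.delta_ne_zero (h : IsAffineBase B A a α) : ∑ i, a i • α i ≠ 0 := by
  intro h0
  obtain ⟨i⟩ := h.gcm.nonempty
  have h1 := Fintype.linearIndependent_iff.1 h.linearIndependent (fun i => (a i : ℝ))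
    (by simpa [Int.cast_smul_eq_zsmul] using h0) i
  exact (h.marks.pos i).ne' (by exact_mod_cast h1)

/-! ### Real roots -/

theorem rootReflection_apply_apply (hB : B.IsSymm) {β : V} (hβ : B β β ≠ 0) (x y : V) :
    B (rootReflection B β x) (rootReflection B β y) = B x y := by
  simp only [rootReflection, map_sub, map_smul, LinearMap.sub_apply, LinearMap.smul_apply,
    smul_eq_mul]
  rw [hB.eq x β]
  field_simp
  ring

theorem rootReflection_rootReflection {β : V} (hβ : B β β ≠ 0) (x : V) :
    rootReflection B β (rootReflection B β x) = x := by
  have : 2 * B β (x - (2 * B β x / B β β) • β) / B β β = -(2 * B β x / B β β) := by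
    simp only [map_sub, map_smul, smul_eq_mul]
    field_simp
    ring
  simp only [rootReflection]
  rw [this]
  module

theorem apply_rootReflection_right (hB : B.IsSymm) {β : V} (hβ : B β β ≠ 0) (x y : V) :
    B x (rootReflection B β y) = B (rootReflection B β x) y := by
  rw [← rootReflection_apply_apply hB hβ x, rootReflection_rootReflection hβ]

/-- Conjugating the reflection in `γ` by an isometric reflection. -/
theorem rootReflection_conj (hB : B.IsSymm) {β : V} (hβ : B β β ≠ 0) (γ x : V) :
    rootReflection B (rootReflection B β γ) x =
      rootReflection B β (rootReflection B γ (rootReflection B β x)) := by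
  have h1 : rootReflection B β (rootReflection B γ (rootReflection B β x)) =
      rootReflection B β (rootReflection B β x) -
        (2 * B γ (rootReflection B β x) / B γ γ) • rootReflection B β γ := by
    rw [rootReflection, rootReflection, rootReflection]
    simp only [rootReflection, map_sub, map_smul, smul_eq_mul]
    module
  rw [h1, rootReflection_rootReflection hβ, apply_rootReflection_right hB hβ, rootReflection,
    rootReflection_apply_apply hB hβ]

theorem IsAffineBase.rootReflection_mem_span (h : IsAffineBase B A a α) (i : ι) {x : V}
    (hx : x ∈ Submodule.span ℤ (Set.range α)) :
    rootReflection B (α i) x ∈ Submodule.span ℤ (Set.range α) := by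
  obtain ⟨c, rfl⟩ := (Submodule.mem_span_range_iff_exists_fun ℤ).1 hx
  have h1 : 2 * B (α i) (∑ j, c j • α j) / B (α i) (α i) = ((∑ j, c j * A i j : ℤ) : ℝ) := by
    rw [div_eq_iff (h.norm_pos i).ne']
    simp only [map_sum, map_zsmul, zsmul_eq_mul, Finset.mul_sum, Int.cast_sum, Int.cast_mul,
      Finset.sum_mul]
    exact Finset.sum_congr rfl fun j _ => by linear_combination (c j : ℝ) * h.cartan i j
  rw [rootReflection, h1, Int.cast_smul_eq_zsmul]
  exact sub_mem hx (Submodule.smul_mem _ _ (Submodule.subset_span ⟨i, rfl⟩))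

theorem IsRealRoot.mem_span (h : IsAffineBase B A a α) {β : V} (hβ : IsRealRoot B α β) :
    β ∈ Submodule.span ℤ (Set.range α) := by
  induction hβ with
  | simple i => exact Submodule.subset_span ⟨i, rfl⟩
  | reflect i β _ ih => exact h.rootReflection_mem_span i ih

theorem IsRealRoot.apply_self_pos (h : IsAffineBase B A a α) (hB : B.IsSymm) {β : V}
    (hβ : IsRealRoot B α β) : 0 < B β β := by
  induction hβ with
  | simple i => exact h.norm_pos i
  | reflect i β _ ih => rwa [rootReflection_apply_apply hB (h.norm_pos i).ne']

/-- Integrality of the pairing of the lattice with all coroots, by transport to simple roots. -/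
theorem IsRealRoot.exists_int (h : IsAffineBase B A a α) (hB : B.IsSymm) {β : V}
    (hβ : IsRealRoot B α β) : ∀ {x : V}, x ∈ Submodule.span ℤ (Set.range α) →
      ∃ k : ℤ, 2 * B x β = k * B β β := by
  induction hβ with
  | simple i =>
    intro x hx
    induction hx using Submodule.span_induction with
    | mem x hx =>
      obtain ⟨j, rfl⟩ := hx
      exact ⟨A i j, by rw [hB.eq, h.cartan]⟩
    | zero => exact ⟨0, by simp⟩
    | add x y _ _ hx hy =>
      obtain ⟨k, hk⟩ := hx
      obtain ⟨l, hl⟩ := hy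
      refine ⟨k + l, ?_⟩
      simp only [map_add, LinearMap.add_apply]
      push_cast
      linear_combination hk + hl
    | smul m x _ hx =>
      obtain ⟨k, hk⟩ := hx
      refine ⟨m * k, ?_⟩
      simp only [map_zsmul, LinearMap.smul_apply, zsmul_eq_mul]
      push_cast
      linear_combination (m : ℝ) * hk
  | reflect i β _ ih =>
    intro x hx
    rw [apply_rootReflection_right hB (h.norm_pos i).ne',
      rootReflection_apply_apply hB (h.norm_pos i).ne']
    exact ih (h.rootReflection_mem_span i hx)

theorem IsRealRoot.rootReflection (h : IsAffineBase B A a α) (hB : B.IsSymm) {β : V}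
    (hβ : IsRealRoot B α β) :
    ∀ {γ : V}, IsRealRoot B α γ → IsRealRoot B α (rootReflection B β γ) := by
  induction hβ with
  | simple i => exact fun hγ => .reflect i _ hγ
  | reflect i β _ ih =>
    intro γ hγ
    rw [rootReflection_conj hB (h.norm_pos i).ne']
    exact .reflect i _ (ih (.reflect i _ hγ))

theorem IsRealRoot.neg (h : IsAffineBase B A a α) (hB : B.IsSymm) {β : V}
    (hβ : IsRealRoot B α β) : IsRealRoot B α (-β) := by
  have h1 := hβ.rootReflection h hB hβ
  rwa [_root_.rootReflection, mul_div_assoc, div_self (hβ.apply_self_pos h hB).ne', mul_one,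
    two_smul, sub_add_cancel_left] at h1

/-- Two real roots at an acute angle differ by a real root or by an isotropic vector. -/
theorem IsRealRoot.sub_of_apply_pos (h : IsAffineBase B A a α) (hB : B.IsSymm) {β γ : V}
    (hβ : IsRealRoot B α β) (hγ : IsRealRoot B α γ) (hpos : 0 < B β γ) :
    IsRealRoot B α (β - γ) ∨ B (β - γ) (β - γ) = 0 := by
  have hβ0 := hβ.apply_self_pos h hB
  have hγ0 := hγ.apply_self_pos h hB
  have hsub := h.apply_self_nonneg hB (sub_mem (hβ.mem_span h) (hγ.mem_span h))
  have hsymm := hB.eq γ β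
  obtain ⟨k, hk⟩ := hγ.exists_int h hB (hβ.mem_span h)
  obtain ⟨l, hl⟩ := hβ.exists_int h hB (hγ.mem_span h)
  have hexp : B (β - γ) (β - γ) = B β β - 2 * B β γ + B γ γ := by
    simp only [map_sub, LinearMap.sub_apply, hsymm]
    ring
  rw [hsymm] at hl
  have hk0 : (0 : ℝ) < k := pos_of_mul_pos_left (by rw [← hk]; positivity) hγ0.le
  have hl0 : (0 : ℝ) < l := pos_of_mul_pos_left (by rw [← hl]; positivity) hβ0.le
  have hk0' : 0 < k := by exact_mod_cast hk0
  have hl0' : 0 < l := by exact_mod_cast hl0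
  by_cases hk1 : k = 1
  · left
    have h1 := hγ.rootReflection h hB hβ
    rwa [_root_.rootReflection, hsymm, hk, hk1, Int.cast_one, one_mul, div_self hγ0.ne',
      one_smul] at h1
  by_cases hl1 : l = 1
  · left
    have h1 := (hβ.rootReflection h hB hγ).neg h hB
    rwa [_root_.rootReflection, hl, hl1, Int.cast_one, one_mul, div_self hβ0.ne',
      one_smul, neg_sub] at h1
  · right
    have hk2 : (2 : ℝ) ≤ k := by exact_mod_cast (by lia : 2 ≤ k)
    have hl2 : (2 : ℝ) ≤ l := by exact_mod_cast (by lia : 2 ≤ l)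
    rw [hexp] at hsub ⊢
    nlinarith [mul_le_mul_of_nonneg_right hk2 hγ0.le, mul_le_mul_of_nonneg_right hl2 hβ0.le]

end AffineBase

/-! ### Indecomposable affine root systems -/

section Indecomposable

variable {V : Type*} [AddCommGroup V] [Module ℝ V] {B : LinearMap.BilinForm ℝ V}
  {Γ : Set V} {δ : V}

namespace IsIndecomposableAffineRootSystem

theorem delta_mem (h : IsIndecomposableAffineRootSystem B Γ δ) : δ ∈ Γ := by
  obtain ⟨n, A, a, α, hα, rfl, rfl⟩ := h
  exact Or.inr ⟨1, one_ne_zero, (one_smul _ _).symm⟩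

theorem delta_ne_zero (h : IsIndecomposableAffineRootSystem B Γ δ) : δ ≠ 0 := by
  obtain ⟨n, A, a, α, hα, rfl, rfl⟩ := h
  exact hα.delta_ne_zero

theorem zsmul_delta_mem (h : IsIndecomposableAffineRootSystem B Γ δ) {m : ℤ} (hm : m ≠ 0) :
    m • δ ∈ Γ := by
  obtain ⟨n, A, a, α, hα, rfl, rfl⟩ := h
  exact Or.inr ⟨m, hm, rfl⟩

theorem exists_base (h : IsIndecomposableAffineRootSystem B Γ δ) :
    ∃ (n : ℕ) (A : Matrix (Fin n) (Fin n) ℤ) (a : Fin n → ℤ) (α : Fin n → V),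
      IsAffineBase B A a α ∧ δ = ∑ i, a i • α i ∧
      (∀ x ∈ AddSubgroup.closure Γ, x ∈ Submodule.span ℤ (Set.range α)) ∧
      ∀ x ∈ Γ, IsRealRoot B α x ∨ ∃ m : ℤ, m ≠ 0 ∧ x = m • δ := by
  obtain ⟨n, A, a, α, hα, rfl, rfl⟩ := h
  refine ⟨n, A, a, α, hα, rfl, ?_, fun x hx => hx⟩
  change AddSubgroup.closure _ ≤ (Submodule.span ℤ (Set.range α)).toAddSubgroup
  rw [AddSubgroup.closure_le]
  rintro x (hx | ⟨m, -, rfl⟩)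
  · exact hx.mem_span hα
  · exact Submodule.smul_mem _ _ (Submodule.sum_mem _ fun i _ =>
      Submodule.smul_mem _ _ (Submodule.subset_span ⟨i, rfl⟩))

theorem apply_self_nonneg (h : IsIndecomposableAffineRootSystem B Γ δ) (hB : B.IsSymm) {x : V}
    (hx : x ∈ AddSubgroup.closure Γ) : 0 ≤ B x x := by
  obtain ⟨n, A, a, α, hα, -, hspan, -⟩ := h.exists_base
  exact hα.apply_self_nonneg hB (hspan x hx)

theorem exists_eq_zsmul (h : IsIndecomposableAffineRootSystem B Γ δ) (hB : B.IsSymm) {x : V}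
    (hx : x ∈ AddSubgroup.closure Γ) (hxx : B x x = 0) : ∃ m : ℤ, x = m • δ := by
  obtain ⟨n, A, a, α, hα, rfl, hspan, -⟩ := h.exists_base
  exact hα.exists_eq_zsmul_delta hB (hspan x hx) hxx

theorem delta_apply (h : IsIndecomposableAffineRootSystem B Γ δ) (hB : B.IsSymm) {x : V}
    (hx : x ∈ Γ) : B δ x = 0 := by
  obtain ⟨n, A, a, α, hα, rfl, hspan, -⟩ := h.exists_base
  exact hα.apply_delta_left hB (hspan x (AddSubgroup.subset_closure hx))

theorem ne_zero (h : IsIndecomposableAffineRootSystem B Γ δ) (hB : B.IsSymm) {x : V}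
    (hx : x ∈ Γ) : x ≠ 0 := by
  obtain ⟨n, A, a, α, hα, -, -, hΓ⟩ := h.exists_base
  rintro rfl
  rcases hΓ 0 hx with h1 | ⟨m, hm, h1⟩
  · simpa using h1.apply_self_pos hα hB
  · rw [← Int.cast_smul_eq_zsmul ℝ] at h1
    exact smul_ne_zero (Int.cast_ne_zero.2 hm) h.delta_ne_zero h1.symm

theorem zsmul_mem (h : IsIndecomposableAffineRootSystem B Γ δ) (hB : B.IsSymm) {x : V}
    (hx : x ∈ Γ) (hxx : B x x = 0) {m : ℤ} (hm : m ≠ 0) : m • x ∈ Γ := by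
  obtain ⟨k, rfl⟩ := h.exists_eq_zsmul hB (AddSubgroup.subset_closure hx) hxx
  rw [smul_smul]
  refine h.zsmul_delta_mem (mul_ne_zero hm ?_)
  rintro rfl
  exact h.ne_zero hB hx (zero_smul _ _)

theorem neg_mem (h : IsIndecomposableAffineRootSystem B Γ δ) (hB : B.IsSymm) {x : V}
    (hx : x ∈ Γ) : -x ∈ Γ := by
  obtain ⟨n, A, a, α, hα, rfl, rfl⟩ := h
  rcases hx with hx | ⟨m, hm, rfl⟩
  · exact Or.inl (hx.neg hα hB)
  · exact Or.inr ⟨-m, neg_ne_zero.2 hm, (neg_smul _ _).symm⟩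

theorem sub_mem_or_eq (h : IsIndecomposableAffineRootSystem B Γ δ) (hB : B.IsSymm) {x y : V}
    (hx : x ∈ Γ) (hy : y ∈ Γ) (hxy : 0 < B x y) : x - y ∈ Γ ∨ x = y := by
  have hsub : x - y ∈ AddSubgroup.closure Γ :=
    sub_mem (AddSubgroup.subset_closure hx) (AddSubgroup.subset_closure hy)
  have key : x - y ∈ Γ ∨ B (x - y) (x - y) = 0 := by
    have hx' := h.delta_apply hB hx
    have hy' := h.delta_apply hB hy
    obtain ⟨n, A, a, α, hα, hδ, rfl⟩ := h
    rcases hx with hx | ⟨m, hm, rfl⟩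
    · rcases hy with hy | ⟨m, hm, rfl⟩
      · exact (hx.sub_of_apply_pos hα hB hy hxy).imp_left Or.inl
      · rw [hB.eq, map_zsmul, LinearMap.smul_apply, hx', smul_zero] at hxy
        exact absurd hxy (lt_irrefl _)
    · rw [map_zsmul, LinearMap.smul_apply, hy', smul_zero] at hxy
      exact absurd hxy (lt_irrefl _)
  refine key.elim Or.inl fun h0 => ?_
  obtain ⟨m, hm⟩ := h.exists_eq_zsmul hB hsub h0
  by_cases hm0 : m = 0
  · exact Or.inr (sub_eq_zero.1 (by rw [hm, hm0, zero_smul]))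
  · exact Or.inl (hm ▸ h.zsmul_delta_mem hm0)

end IsIndecomposableAffineRootSystem

end Indecomposable

/-! ### Affine root systems -/

section Affine

variable {V : Type*} [AddCommGroup V] [Module ℝ V] {B : LinearMap.BilinForm ℝ V} {Δ : Set V}

namespace IsAffineRootSystem

theorem apply_self_nonneg (h : IsAffineRootSystem B Δ) (hB : B.IsSymm) {x : V} (hx : x ∈ Δ) :
    0 ≤ B x x := by
  obtain ⟨r, Γ, δ, E, -, hΓ, -, -, -, rfl⟩ := h
  obtain ⟨k, hk⟩ := Set.mem_iUnion.1 hx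
  exact (hΓ k).apply_self_nonneg hB (AddSubgroup.subset_closure hk)

theorem neg_mem (h : IsAffineRootSystem B Δ) (hB : B.IsSymm) {x : V} (hx : x ∈ Δ) : -x ∈ Δ := by
  obtain ⟨r, Γ, δ, E, -, hΓ, -, -, -, rfl⟩ := h
  obtain ⟨k, hk⟩ := Set.mem_iUnion.1 hx
  exact Set.mem_iUnion.2 ⟨k, (hΓ k).neg_mem hB hk⟩

theorem ne_zero (h : IsAffineRootSystem B Δ) (hB : B.IsSymm) {x : V} (hx : x ∈ Δ) : x ≠ 0 := by
  obtain ⟨r, Γ, δ, E, -, hΓ, -, -, -, rfl⟩ := h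
  obtain ⟨k, hk⟩ := Set.mem_iUnion.1 hx
  exact (hΓ k).ne_zero hB hk

theorem zsmul_mem (h : IsAffineRootSystem B Δ) (hB : B.IsSymm) {x : V} (hx : x ∈ Δ)
    (hxx : B x x = 0) {m : ℤ} (hm : m ≠ 0) : m • x ∈ Δ := by
  obtain ⟨r, Γ, δ, E, -, hΓ, -, -, -, rfl⟩ := h
  obtain ⟨k, hk⟩ := Set.mem_iUnion.1 hx
  exact Set.mem_iUnion.2 ⟨k, (hΓ k).zsmul_mem hB hk hxx hm⟩

/-- Roots at an acute angle lie in the same component, and their difference is a root or zero. -/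
theorem sub_mem_or_eq (h : IsAffineRootSystem B Δ) (hB : B.IsSymm) {x y : V} (hx : x ∈ Δ)
    (hy : y ∈ Δ) (hxy : 0 < B x y) : x - y ∈ Δ ∨ x = y := by
  obtain ⟨r, Γ, δ, E, -, hΓ, horth, -, -, rfl⟩ := h
  obtain ⟨k, hk⟩ := Set.mem_iUnion.1 hx
  obtain ⟨l, hl⟩ := Set.mem_iUnion.1 hy
  obtain rfl : k = l := by
    by_contra hne
    exact hxy.ne' (horth k l hne x hk y hl)
  exact ((hΓ k).sub_mem_or_eq hB hk hl hxy).imp_left fun h1 => Set.mem_iUnion.2 ⟨k, h1⟩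

theorem exists_linearIndepOn (h : IsAffineRootSystem B Δ) (hB : B.IsSymm) :
    ∃ E : Set V, LinearIndepOn ℝ id E ∧
      ∀ x ∈ Δ, B x x = 0 → ∃ e ∈ E, ∃ m : ℤ, x = m • e := by
  obtain ⟨r, Γ, δ, E, -, hΓ, -, hE, hδ, rfl⟩ := h
  refine ⟨E, hE, fun x hx hxx => ?_⟩
  obtain ⟨k, hk⟩ := Set.mem_iUnion.1 hx
  obtain ⟨m, rfl⟩ := (hΓ k).exists_eq_zsmul hB (AddSubgroup.subset_closure hk) hxx
  obtain ⟨e, he, m', hm'⟩ := hδ k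
  exact ⟨e, he, m * m', by rw [hm', smul_smul]⟩

theorem _root_.AddSubgroup.apply_eq_zero_of_mem_closure {s t : Set V}
    (hst : ∀ x ∈ s, ∀ y ∈ t, B x y = 0) {x y : V} (hx : x ∈ AddSubgroup.closure s)
    (hy : y ∈ AddSubgroup.closure t) : B x y = 0 := by
  induction hx using AddSubgroup.closure_induction with
  | mem x hx =>
    induction hy using AddSubgroup.closure_induction with
    | mem y hy => exact hst x hx y hy
    | zero => exact map_zero _
    | add y z _ _ h1 h2 => rw [map_add, h1, h2, add_zero]
    | neg y _ h1 => rw [map_neg, h1, neg_zero]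
  | zero => rw [map_zero, LinearMap.zero_apply]
  | add x z _ _ h1 h2 => rw [map_add, LinearMap.add_apply, h1, h2, add_zero]
  | neg x _ h1 => rw [map_neg, LinearMap.neg_apply, h1, neg_zero]

/-- Isotropic vectors of the root lattice are integer combinations of imaginary roots: each of
their orthogonal components is isotropic by semidefiniteness. -/
theorem mem_closure_isotropic (h : IsAffineRootSystem B Δ) (hB : B.IsSymm) {x : V}
    (hx : x ∈ AddSubgroup.closure Δ) (hxx : B x x = 0) :
    x ∈ AddSubgroup.closure {y | y ∈ Δ ∧ B y y = 0} := by
  obtain ⟨r, Γ, δ, E, -, hΓ, horth, -, -, rfl⟩ := h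
  have hdec : ∃ q : Fin r → V, (∀ k, q k ∈ AddSubgroup.closure (Γ k)) ∧ x = ∑ k, q k := by
    clear hxx
    induction hx using AddSubgroup.closure_induction with
    | mem x hx =>
      obtain ⟨k, hk⟩ := Set.mem_iUnion.1 hx
      refine ⟨Pi.single k x, fun l => ?_, by simp⟩
      by_cases hl : l = k
      · subst hl
        simpa using AddSubgroup.subset_closure hk
      · simp [hl]
    | zero => exact ⟨0, fun k => zero_mem _, by simp⟩
    | add x y _ _ hx hy =>
      obtain ⟨p, hp, rfl⟩ := hx
      obtain ⟨q, hq, rfl⟩ := hy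
      exact ⟨p + q, fun k => add_mem (hp k) (hq k), by simp [Finset.sum_add_distrib]⟩
    | neg x _ hx =>
      obtain ⟨p, hp, rfl⟩ := hx
      exact ⟨-p, fun k => AddSubgroup.neg_mem _ (hp k), by simp⟩
  obtain ⟨q, hq, rfl⟩ := hdec
  have hsum : B (∑ k, q k) (∑ k, q k) = ∑ k, B (q k) (q k) := by
    simp only [map_sum, LinearMap.sum_apply]
    refine Finset.sum_congr rfl fun k _ => Finset.sum_eq_single k (fun l _ hlk => ?_) (by simp)
    exact AddSubgroup.apply_eq_zero_of_mem_closure (horth l k hlk) (hq l) (hq k)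
  rw [hsum, Finset.sum_eq_zero_iff_of_nonneg
    fun k _ => (hΓ k).apply_self_nonneg hB (hq k)] at hxx
  refine sum_mem fun k hk => ?_
  obtain ⟨m, hm⟩ := (hΓ k).exists_eq_zsmul hB (hq k) (hxx k hk)
  rw [hm]
  refine AddSubgroup.zsmul_mem _ (AddSubgroup.subset_closure ?_) m
  exact ⟨Set.mem_iUnion.2 ⟨k, (hΓ k).delta_mem⟩, (hΓ k).delta_apply hB (hΓ k).delta_mem⟩

end IsAffineRootSystem

theorem LinearIndepOn.exists_dual {E : Set V} (hE : LinearIndepOn ℝ id E) {e : V} (he : e ∈ E) :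
    ∃ f : V →ₗ[ℝ] ℝ, f e = 1 ∧ ∀ e' ∈ E, e' ≠ e → f e' = 0 := by
  let b := Module.Basis.extend hE
  have hb : ∀ x (hx : x ∈ E), b.repr x = Finsupp.single ⟨x, hE.subset_extend _ hx⟩ 1 := by
    intro x hx
    rw [← b.repr_self]
    simp [b, Module.Basis.extend_apply_self]
  refine ⟨b.coord ⟨e, hE.subset_extend _ he⟩, ?_, fun e' he' hne => ?_⟩
  · rw [Module.Basis.coord_apply, hb e he, Finsupp.single_eq_same]
  · rw [Module.Basis.coord_apply, hb e' he', Finsupp.single_eq_of_ne]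
    exact fun h => hne (congrArg Subtype.val h).symm

/-! ### Closed subsystems -/

/-- The isotropic case: only one element `e` of the independent set matters, and the multipliers of
`e` in the subsystem satisfy the hypotheses of `Int.mem_of_mem_closure_of_add_mem`. -/
theorem IsClosedIn.mem_of_isotropic {Δ₁ : Set V} (hB : B.IsSymm) (hΔ : IsAffineRootSystem B Δ)
    (hΔ₁ : IsAffineRootSystem B Δ₁) (hsub : Δ₁ ⊆ Δ) (hcl : IsClosedIn Δ₁ Δ) {x : V}
    (hx : x ∈ Δ) (hxx : B x x = 0) (hxL : x ∈ AddSubgroup.closure Δ₁) : x ∈ Δ₁ := by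
  obtain ⟨E, hE, hiso⟩ := hΔ.exists_linearIndepOn hB
  obtain ⟨e, he, N, rfl⟩ := hiso x hx hxx
  obtain ⟨f, hfe, hf⟩ := hE.exists_dual he
  have hN : N ≠ 0 := by
    rintro rfl
    exact hΔ.ne_zero hB hx (zero_smul _ _)
  have hee : B e e = 0 := by simpa [hN] using hxx
  have hzz : ∀ k : ℤ, B (k • e) (k • e) = 0 := fun k => by simp [hee]
  -- the multipliers of `e` in the subsystem, together with zero
  let S : Set ℤ := {m | m = 0 ∨ m • e ∈ Δ₁}
  suffices h : N ∈ S from h.resolve_left hN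
  refine Int.mem_of_mem_closure_of_add_mem (Or.inl rfl) ?_ ?_ ?_
  · rintro s hs t
    by_cases hts : t * s = 0
    · exact Or.inl hts
    · right
      rw [← smul_smul]
      exact hΔ₁.zsmul_mem hB (hs.resolve_left (right_ne_zero_of_mul hts)) (hzz s)
        (left_ne_zero_of_mul hts)
  · rintro s hs t ht ⟨m, hm⟩
    rcases hs with rfl | hs
    · simpa using ht
    rcases ht with rfl | ht
    · rw [add_zero]
      exact Or.inr hs
    by_cases hst : s + t = 0
    · exact Or.inl hst
    · right
      rw [add_smul]
      refine hcl _ hs _ ht ?_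
      rw [← add_smul, hm, mul_comm, ← smul_smul]
      refine hΔ.zsmul_mem hB hx hxx ?_
      rintro rfl
      exact hst (by simpa using hm)
  · have key : ∀ y ∈ AddSubgroup.closure {y | y ∈ Δ₁ ∧ B y y = 0},
        ∃ z ∈ AddSubgroup.closure S, f y = z := by
      intro y hy
      induction hy using AddSubgroup.closure_induction with
      | mem y hy =>
        obtain ⟨e', he', m, rfl⟩ := hiso y (hsub hy.1) hy.2
        by_cases hne : e' = e
        · subst hne
          exact ⟨m, AddSubgroup.subset_closure (Or.inr hy.1), by simp [hfe]⟩
        · exact ⟨0, zero_mem _, by simp [hf e' he' hne]⟩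
      | zero => exact ⟨0, zero_mem _, by simp⟩
      | add y z _ _ hy hz =>
        obtain ⟨k, hk, hk'⟩ := hy
        obtain ⟨l, hl, hl'⟩ := hz
        exact ⟨k + l, add_mem hk hl, by simp [hk', hl']⟩
      | neg y _ hy =>
        obtain ⟨k, hk, hk'⟩ := hy
        exact ⟨-k, neg_mem hk, by simp [hk']⟩
    obtain ⟨z, hz, hz'⟩ := key _ (hΔ₁.mem_closure_isotropic hB hxL hxx)
    have : N = z := by
      simp only [map_zsmul, hfe, zsmul_eq_mul, mul_one] at hz'
      exact_mod_cast hz'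
    rwa [this]

/-- A root of `Δ` that is a sum of elements of `Δ₁` lies in `Δ₁`, by removing one summand at an acute
angle with the sum at a time. -/
theorem IsClosedIn.multiset_sum_mem {Δ₁ : Set V} (hB : B.IsSymm) (hΔ : IsAffineRootSystem B Δ)
    (hΔ₁ : IsAffineRootSystem B Δ₁) (hsub : Δ₁ ⊆ Δ) (hcl : IsClosedIn Δ₁ Δ) (n : ℕ) :
    ∀ s : Multiset V, s.card = n → (∀ y ∈ s, y ∈ Δ₁) → s.sum ∈ Δ → s.sum ∈ Δ₁ := by
  induction n with
  | zero =>
    intro s hs _ hx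
    rw [Multiset.card_eq_zero.1 hs] at hx
    exact absurd rfl (hΔ.ne_zero hB hx)
  | succ n ih =>
    intro s hs hmem hx
    by_cases hxx : B s.sum s.sum = 0
    · exact hcl.mem_of_isotropic hB hΔ hΔ₁ hsub hx hxx
        (AddSubgroup.multiset_sum_mem _ _ fun y hy => AddSubgroup.subset_closure (hmem y hy))
    have hpos : 0 < B s.sum s.sum := lt_of_le_of_ne (hΔ.apply_self_nonneg hB hx) (Ne.symm hxx)
    obtain ⟨β, hβ, hβpos⟩ : ∃ β ∈ s, 0 < B s.sum β := by
      by_contra! hle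
      have h1 : B s.sum s.sum = (s.map (B s.sum)).sum := map_multiset_sum (B s.sum) s
      have h2 : (s.map (B s.sum)).sum ≤ 0 := by
        refine (Multiset.sum_le_card_nsmul _ 0 fun r hr => ?_).trans_eq (smul_zero _)
        obtain ⟨β, hβ, rfl⟩ := Multiset.mem_map.1 hr
        exact hle β hβ
      linarith
    obtain ⟨t, rfl⟩ := Multiset.exists_cons_of_mem hβ
    have hβ₁ := hmem β hβ
    rcases hΔ.sub_mem_or_eq hB hx (hsub hβ₁) hβpos with h1 | h1
    · rw [Multiset.sum_cons] at hx ⊢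
      rw [Multiset.sum_cons, add_sub_cancel_left] at h1
      exact hcl _ hβ₁ _ (ih t (by simpa using hs)
        (fun y hy => hmem y (Multiset.mem_cons_of_mem hy)) h1) hx
    · rwa [h1]

end Affine

theorem theorem4p3 {V : Type*} [AddCommGroup V] [Module ℝ V]
    (B : LinearMap.BilinForm ℝ V) (hB : B.IsSymm) (Δ Δ₁ : Set V)
    (hΔ : IsAffineRootSystem B Δ) (hΔ₁ : IsAffineRootSystem B Δ₁) (hsub : Δ₁ ⊆ Δ) :
    IsClosedIn Δ₁ Δ ↔ Δ₁ = Δ ∩ (rootLattice Δ₁ : Set V) := by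
  constructor
  · intro hcl
    refine Set.Subset.antisymm (fun x hx => ⟨hsub hx, AddSubgroup.subset_closure hx⟩) ?_
    rintro x ⟨hx, hxL⟩
    have hneg : Δ₁ ∪ -Δ₁ = Δ₁ := Set.union_eq_self_of_subset_right fun y hy => by
      simpa using hΔ₁.neg_mem hB (Set.mem_neg.1 hy)
    have hxM : x ∈ AddSubmonoid.closure Δ₁ := by
      rw [← hneg, ← AddSubgroup.closure_toAddSubmonoid]
      exact hxL
    obtain ⟨s, hs, rfl⟩ := AddSubmonoid.exists_multiset_of_mem_closure hxM
    exact hcl.multiset_sum_mem hB hΔ hΔ₁ hsub _ s rfl hs hx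
  · intro heq x hx y hy hxy
    rw [heq]
    exact ⟨hxy, add_mem (AddSubgroup.subset_closure hx) (AddSubgroup.subset_closure hy)⟩
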